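/- **Theorem 4.1.** Let $X$ be a finite-dimensional Euclidean space. Identify its Clifford algebra, in which $v^2=\|v\|^2$ for $v\in X$ and juxtaposition denotes the product, with $\bigwedge X$ as a vector space in the canonical way. Let $\tilde M$ be the reversion of a multivector $M$, given by $(v_1\wedge\dots\wedge v_k)^\sim=v_k\wedge\dots\wedge v_1$, and let $\|M\|=\sqrt{\langle\tilde M M\rangle_0}$, where $\langle\cdot\rangle_0$ is the grade-$0$ component. A $p$-blade is an element $v_1\wedge\dots\wedge v_p$ with $v_i\in X$ (a $0$-blade is a scalar). For a nonzero blade $A=v_1\wedge\dots\wedge v_p$ put $[A]=\operatorname{span}(v_1,\dots,v_p)$, and $[A]=\{0\}$ if $p=0$. Let $A,B\in\bigwedge^pX$ be blades of the same grade $p\ge 0$. If $A,B\neq0$, associated principal bases of $[A]$ and $[B]$ are orthonormal bases $(e_1,\dots,e_p)$ of $[A]$ and $(f_1,\dots,f_p)$ of $[B]$ with $e_i\cdot f_j=\delta_{ij}\cos\theta_i$, where $0\le\theta_1\le\dots\le\theta_p\le\frac{\pi}{2}$ are the principal angles. Given such bases: - let $A=\epsilon_A\|A\|\,e_1\cdots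 e_p$ and $B=\epsilon_B\|B\|\,f_1\cdots f_p$ with $\epsilon_A,\epsilon_B\in\{1,-1\}$, and $\epsilon_{A,B}=\epsilon_A\epsilon_B$; - with $d=\dim([A]\cap[B])$, let $I_i=0$ for $i\le d$, and $I_i=\dfrac{e_i\wedge f_i}{\|e_i\wedge f_i\|}$ for $i>d$; - let $\theta_i^+=\theta_i$ and $I_i^+=I_i$ for $i<p$, and also for $i=p$ if $\epsilon_{A,B}=1$; if $\epsilon_{A,B}=-1$ let $\theta_p^+=\pi-\theta_p$ and $I_p^+=-I_p$. The oriented angle bivector formed with these bases is $\Phi_{A,B}=\sum_{i=1}^p\theta_i^+I_i^+$. If $A=0$ or $B=0$, put $\Phi_{A,B}=0$. Suppose that $A$ and $B$ are not nonzero blades of the same subspace with opposite orientations, that is, if $A\ne0$ then $B\neq cA$ for all real $c<0$. Then an oriented angle bivector $\Phi_{A,B}$ exists, and for every choice of associated principal bases the exponential series $e^{\Phi_{A,B}}=\sum_{k\ge0}\Phi_{A,B}^k/k!$ converges and $$\tilde A B=\|A\|\,\|B\|\,e^{\Phi_{A,B}}.$$ -/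

import Mathlib

namespace BladeAngle

/-- The quadratic form `x ↦ ⟪x, x⟫` of a Euclidean space. -/
noncomputable def euclideanForm (X : Type*) [NormedAddCommGroup X] [InnerProductSpace ℝ X] :
    QuadraticForm ℝ X :=
  LinearMap.BilinMap.toQuadraticMap (innerₗ X)

noncomputable instance instInvertibleTwoReal : Invertible (2 : ℝ) :=
  invertibleOfNonzero two_ne_zero

/-- Multivectors. The ring product is the Clifford geometric product, with `v v = ⟪v, v⟫` for
vectors. As a vector space this is identified with the exterior algebra `⋀ X` by the canonical
linear isomorphism `CliffordAlgebra.equivExterior`. -/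
abbrev Multivector (X : Type*) [NormedAddCommGroup X] [InnerProductSpace ℝ X] : Type _ :=
  CliffordAlgebra (euclideanForm X)

variable {X : Type*} [NormedAddCommGroup X] [InnerProductSpace ℝ X]

/-- A vector seen as a multivector. -/
noncomputable def vec (x : X) : Multivector X := CliffordAlgebra.ι (euclideanForm X) x

/-- The exterior product `v₁ ∧ ⋯ ∧ vₚ`, as a multivector. -/
noncomputable def wedge {p : ℕ} (v : Fin p → X) : Multivector X :=
  (CliffordAlgebra.equivExterior (euclideanForm X)).symm (ExteriorAlgebra.ιMulti ℝ p v)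

/-- The Clifford product `v₁ v₂ ⋯ vₚ`. -/
noncomputable def geomProd {p : ℕ} (v : Fin p → X) : Multivector X :=
  (List.ofFn fun i => vec (v i)).prod

/-- The reversion `M ↦ M̃`. -/
noncomputable def rev (M : Multivector X) : Multivector X := CliffordAlgebra.reverse M

/-- The component of grade `0`. -/
noncomputable def scalarPart (M : Multivector X) : ℝ :=
  ExteriorAlgebra.algebraMapInv (CliffordAlgebra.equivExterior (euclideanForm X) M)

/-- `‖M‖ = √⟨M̃ M⟩₀`. -/
noncomputable def mnorm (M : Multivector X) : ℝ := Real.sqrt (scalarPart (rev M * M))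

/-- `B` is a `p`-blade. The scalar factor can be absorbed into `v₁` when `1 ≤ p`; for `p = 0` it
makes the `0`-blades exactly the scalars. -/
def IsBlade (p : ℕ) (B : Multivector X) : Prop :=
  ∃ (r : ℝ) (v : Fin p → X), B = r • wedge v

/-- For a nonzero `p`-blade `B` and a subspace `V`: `V = [B]`. -/
def IsBladeSpace (p : ℕ) (B : Multivector X) (V : Submodule ℝ X) : Prop :=
  ∃ (r : ℝ) (v : Fin p → X), B = r • wedge v ∧ V = Submodule.span ℝ (Set.range v)

/-- `e` and `f` are associated principal bases of the `p`-dimensional subspaces `V` and `W`, with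
principal angles `0 ≤ θ₁ ≤ ⋯ ≤ θₚ ≤ π / 2`. -/
structure IsPrincipal {p : ℕ} (V W : Submodule ℝ X) (e f : Fin p → X) (θ : Fin p → ℝ) :
    Prop where
  orthonormal_left : Orthonormal ℝ e
  span_left : Submodule.span ℝ (Set.range e) = V
  orthonormal_right : Orthonormal ℝ f
  span_right : Submodule.span ℝ (Set.range f) = W
  angle_monotone : Monotone θ
  angle_mem : ∀ i, θ i ∈ Set.Icc 0 (Real.pi / 2)
  inner_eq : ∀ i j, inner ℝ (e i) (f j) = if i = j then Real.cos (θ i) else 0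

/-- `B = ε ‖B‖ f₁ f₂ ⋯ fₚ` with `ε = ±1`. -/
def HasOrientation {p : ℕ} (B : Multivector X) (f : Fin p → X) (ε : ℝ) : Prop :=
  (ε = 1 ∨ ε = -1) ∧ B = (ε * mnorm B) • geomProd f

/-- The principal bivectors `I_i` of `V` and `W`, zero for the first `dim (V ∩ W)` indices.
Indices start at `0` here. -/
noncomputable def principalBivector {p : ℕ} (V W : Submodule ℝ X) (e f : Fin p → X) (i : Fin p) :
    Multivector X :=
  if (i : ℕ) < Module.finrank ℝ (V ⊓ W : Submodule ℝ X) then 0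
  else (mnorm (wedge ![e i, f i]))⁻¹ • wedge ![e i, f i]

open Classical in
/-- The oriented principal angles: the last one becomes `π - θₚ` when the relative orientation `ε`
is not `1`. -/
noncomputable def orientedAngle {p : ℕ} (θ : Fin p → ℝ) (ε : ℝ) (i : Fin p) : ℝ :=
  if (i : ℕ) + 1 < p ∨ ε = 1 then θ i else Real.pi - θ i

open Classical in
/-- The oriented principal bivectors: the last one becomes `-Iₚ` when the relative orientation `ε`
is not `1`. -/
noncomputable def orientedBivector {p : ℕ} (V W : Submodule ℝ X) (e f : Fin p → X) (ε : ℝ)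
    (i : Fin p) : Multivector X :=
  if (i : ℕ) + 1 < p ∨ ε = 1 then principalBivector V W e f i else -principalBivector V W e f i

/-- `Φ` is the oriented angle bivector `Φ_{A,B} = ∑ θ_i⁺ I_i⁺` of the `p`-blades `A` and `B`, formed
with some choice of associated principal bases of `[A]` and `[B]`; it is `0` if `A` or `B` is. -/
def IsOrientedAngleBivector (p : ℕ) (A B Φ : Multivector X) : Prop :=
  ((A = 0 ∨ B = 0) ∧ Φ = 0) ∨
  (A ≠ 0 ∧ B ≠ 0 ∧
    ∃ (V W : Submodule ℝ X) (e f : Fin p → X) (θ : Fin p → ℝ) (εA εB : ℝ),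
      IsBladeSpace p A V ∧ IsBladeSpace p B W ∧ IsPrincipal V W e f θ ∧
      HasOrientation A e εA ∧ HasOrientation B f εB ∧
      Φ = ∑ i, orientedAngle θ (εA * εB) i • orientedBivector V W e f (εA * εB) i)

/-- `E = e ^ M`, i.e. the series `∑ Mᵏ / k!` converges to `E` in the canonical topology of the
algebra as a real vector space (its only Hausdorff vector space topology when `X` has finite
dimension, hence the one of the norm `mnorm`). -/
def HasExp (M E : Multivector X) : Prop :=
  letI : TopologicalSpace (Multivector X) := moduleTopology ℝ (Multivector X)
  HasSum (fun k : ℕ => ((k.factorial : ℝ)⁻¹) • M ^ k) E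

/-- The exponential `e ^ M = ∑ Mᵏ / k!`. -/
noncomputable def mexp (M : Multivector X) : Multivector X :=
  letI : TopologicalSpace (Multivector X) := moduleTopology ℝ (Multivector X)
  ∑' k : ℕ, ((k.factorial : ℝ)⁻¹) • M ^ k

end BladeAngle

/-! In principal bases, `e i` and `f i` are orthogonal to `e j` and `f j` for `i ≠ j`, so each pair
product `e i * f i` commutes with the vectors of the other pairs. Hence `rev A * B` is `εA εB ‖A‖
‖B‖` times the product of the `e i * f i` (`rev_geomProd_mul_geomProd`). If `θ i ≠ 0`, then `e i * f
i = cos θ i + sin θ i • I i` with `I i * I i = -1`, which is the exponential of `θ i • I i`; if `θ i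
= 0`, then `e i = f i` and both are `1`. A sign `-1` is absorbed by the last factor: `-(cos θ + sin
θ • I) = cos (π - θ) + sin (π - θ) • (-I)`. This needs a nonzero last angle; otherwise all angles
vanish, `e = f`, and `B` is a negative multiple of `A`. Since the summands of the angle bivector
commute, the exponentials multiply (`IsPrincipal.hasExp_oriented`).

Existence is the singular value decomposition of the orthogonal projection from `[A]` to `[B]`
(`exists_isPrincipal`). -/

namespace BladeAngle

/-! ### Exponentials in Banach algebras and the regular representation. -/

section NormedExp

/-- Euler's formula for a square root of `-1` in a real Banach algebra. -/
theorem exp_smul_of_mul_self_eq_neg_one {𝔸 : Type*} [NormedRing 𝔸] [NormedAlgebra ℝ 𝔸]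
    [CompleteSpace 𝔸] {I : 𝔸} (hI : I * I = -1) (t : ℝ) :
    NormedSpace.exp (t • I) = Real.cos t • (1 : 𝔸) + Real.sin t • I := by
  -- The algebra map from `ℂ` sending `i` to `I` is continuous, so it transports the complex Euler
  -- formula.
  let F : ℂ →ₐ[ℝ] 𝔸 := Complex.lift ⟨I, hI⟩
  have hF : ∀ z : ℂ, F z = z.re • (1 : 𝔸) + z.im • I := fun z => by
    simp [F, Complex.liftAux_apply, Algebra.algebraMap_eq_smul_one]
  have hc : Continuous F := F.toLinearMap.continuous_of_finiteDimensional
  let : NormedAlgebra ℚ 𝔸 := NormedAlgebra.restrictScalars ℚ ℝ 𝔸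
  have h := NormedSpace.map_exp F hc ((t : ℂ) * Complex.I)
  rw [← Complex.exp_eq_exp_ℂ, hF, hF] at h
  simpa [Complex.exp_ofReal_mul_I_re, Complex.exp_ofReal_mul_I_im] using h.symm

/-- A finite-dimensional real algebra embeds in a Banach algebra of operators, with a linear
retraction. -/
theorem exists_operator_representation (A : Type*) [Ring A] [Algebra ℝ A] [Module.Finite ℝ A] :
    ∃ (n : ℕ) (L : A →ₐ[ℝ] ((Fin n → ℝ) →L[ℝ] (Fin n → ℝ)))
      (ρ : ((Fin n → ℝ) →L[ℝ] (Fin n → ℝ)) →ₗ[ℝ] A), ∀ a, ρ (L a) = a := by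
  let φ := (Module.finBasis ℝ A).equivFun
  refine ⟨_, ((Module.End.toContinuousLinearMap _).toAlgHom.comp
    (φ.conjAlgEquiv ℝ).toAlgHom).comp (Algebra.lmul ℝ A),
    -- `L` is left multiplication in coordinates; evaluating an operator at `1` recovers the
    -- multiplier.
    φ.symm.toLinearMap ∘ₗ LinearMap.applyₗ (φ 1) ∘ₗ ContinuousLinearMap.coeLM ℝ, fun a => ?_⟩
  change φ.symm (φ (a * φ.symm (φ 1))) = a
  simp

end NormedExp

variable {X : Type*} [NormedAddCommGroup X] [InnerProductSpace ℝ X]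

/-! ### Finite dimension of the Clifford algebra. -/

section Finite

theorem exteriorAlgebra_finite (M : Type*) [AddCommGroup M] [Module ℝ M] [Module.Finite ℝ M] :
    Module.Finite ℝ (ExteriorAlgebra ℝ M) := by
  have hbot : ∀ k, Module.finrank ℝ M < k → (⋀[ℝ]^k M) = ⊥ := fun k hk => by
    rw [← ExteriorAlgebra.ιMulti_span_fixedDegree, Submodule.span_eq_bot]
    rintro _ ⟨v, rfl⟩
    refine AlternatingMap.map_linearDependent _ v fun h => ?_
    have := h.fintype_card_le_finrank
    simp at this
    omega
  have htop : (⨆ k, ⋀[ℝ]^k M) = ⊤ :=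
    (DirectSum.Decomposition.isInternal fun k => ⋀[ℝ]^k M).submodule_iSup_eq_top
  rw [Module.finite_def, ← htop]
  have : (⨆ k, ⋀[ℝ]^k M) = ⨆ k : Fin (Module.finrank ℝ M + 1), ⋀[ℝ]^(k : ℕ) M := by
    refine le_antisymm (iSup_le fun k => ?_) (iSup_le fun k => le_iSup (fun k => ⋀[ℝ]^k M) k.1)
    by_cases hk : k < Module.finrank ℝ M + 1
    · exact le_iSup (fun k : Fin (Module.finrank ℝ M + 1) => ⋀[ℝ]^(k : ℕ) M) ⟨k, hk⟩
    · rw [hbot k (by omega)]; exact bot_le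
  rw [this]
  exact Submodule.fg_iSup _ fun k => Module.Finite.iff_fg.1 inferInstance

instance multivector_finite [FiniteDimensional ℝ X] : Module.Finite ℝ (Multivector X) :=
  haveI := exteriorAlgebra_finite X
  Module.Finite.equiv (CliffordAlgebra.equivExterior (euclideanForm X)).symm

end Finite

/-! ### The exponential series of multivectors. -/

section Exp

/-- Both `L` and `ρ` are linear and continuous, so `L` carries the series into the Banach algebra
and `ρ` carries it back. -/
theorem hasExp_iff {n : ℕ} (L : Multivector X →ₐ[ℝ] ((Fin n → ℝ) →L[ℝ] (Fin n → ℝ)))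
    (ρ : ((Fin n → ℝ) →L[ℝ] (Fin n → ℝ)) →ₗ[ℝ] Multivector X) (hρ : ∀ a, ρ (L a) = a)
    (M E : Multivector X) : HasExp M E ↔ NormedSpace.exp (L M) = L E := by
  let : TopologicalSpace (Multivector X) := moduleTopology ℝ (Multivector X)
  have : IsModuleTopology ℝ (Multivector X) := ⟨rfl⟩
  have := IsModuleTopology.topologicalAddGroup ℝ (Multivector X)
  have hs := NormedSpace.exp_series_hasSum_exp' (𝕂 := ℝ) (L M)
  constructor
  · intro h
    have hc : Continuous L := IsModuleTopology.continuous_of_linearMap L.toLinearMap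
    have h2 := HasSum.map (show HasSum (fun k : ℕ => ((k.factorial : ℝ)⁻¹) • M ^ k) E from h) L hc
    exact hs.unique (by simpa only [Function.comp_def, map_smul, map_pow] using h2)
  · intro h
    have hc : Continuous ρ := ρ.continuous_of_finiteDimensional
    have h2 := hs.map ρ hc
    rw [h, hρ] at h2
    change HasSum (fun k : ℕ => ((k.factorial : ℝ)⁻¹) • M ^ k) E
    convert h2 using 2 with k
    simp only [Function.comp_apply, map_smul, ← map_pow, hρ]

variable [FiniteDimensional ℝ X] {M N E F : Multivector X}

theorem hasExp_zero : HasExp (0 : Multivector X) 1 := by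
  obtain ⟨n, L, ρ, hρ⟩ := exists_operator_representation (Multivector X)
  simp [hasExp_iff L ρ hρ]

theorem HasExp.add (hM : HasExp M E) (hN : HasExp N F) (h : Commute M N) :
    HasExp (M + N) (E * F) := by
  obtain ⟨n, L, ρ, hρ⟩ := exists_operator_representation (Multivector X)
  rw [hasExp_iff L ρ hρ] at *
  let : NormedAlgebra ℚ ((Fin n → ℝ) →L[ℝ] (Fin n → ℝ)) := NormedAlgebra.restrictScalars ℚ ℝ _
  rw [map_add, map_mul, NormedSpace.exp_add_of_commute (h.map L), hM, hN]

theorem hasExp_smul {I : Multivector X} (hI : I * I = -1) (t : ℝ) :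
    HasExp (t • I) (Real.cos t • 1 + Real.sin t • I) := by
  obtain ⟨n, L, ρ, hρ⟩ := exists_operator_representation (Multivector X)
  rw [hasExp_iff L ρ hρ, map_smul, map_add, map_smul, map_smul, map_one]
  have hL : L I * L I = -1 := by rw [← map_mul, hI, map_neg, map_one]
  exact exp_smul_of_mul_self_eq_neg_one hL t

theorem HasExp.mexp_eq (h : HasExp M E) : mexp M = E := by
  let : TopologicalSpace (Multivector X) := moduleTopology ℝ (Multivector X)
  have : IsModuleTopology ℝ (Multivector X) := ⟨rfl⟩
  obtain ⟨n, L, ρ, hρ⟩ := exists_operator_representation (Multivector X)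
  have hc : Continuous L := IsModuleTopology.continuous_of_linearMap L.toLinearMap
  have : T2Space (Multivector X) :=
    T2Space.of_injective_continuous (Function.LeftInverse.injective hρ) hc
  exact HasSum.tsum_eq h

theorem hasExp_sum {p : ℕ} (Φ g : Fin p → Multivector X)
    (hc : ∀ i j, i ≠ j → Commute (Φ i) (Φ j)) (h : ∀ i, HasExp (Φ i) (g i)) :
    HasExp (∑ i, Φ i) (List.ofFn g).prod := by
  induction p with
  | zero => simpa using hasExp_zero
  | succ p ih =>
    rw [Fin.sum_univ_succ, List.ofFn_succ, List.prod_cons]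
    refine (h 0).add (ih _ _ (fun i j hij => hc _ _ (by simpa using hij)) fun i => h _) ?_
    exact Commute.sum_right _ _ _ fun i _ => hc _ _ (Fin.succ_ne_zero i).symm

end Exp

/-! ### Products of vectors, reversion and the scalar part. -/

section Vectors

theorem vec_mul_self (x : X) : vec x * vec x = algebraMap ℝ (Multivector X) (inner ℝ x x) := by
  rw [vec, CliffordAlgebra.ι_sq_scalar]; rfl

theorem vec_mul_add_swap (x y : X) :
    vec x * vec y + vec y * vec x = algebraMap ℝ (Multivector X) (2 * inner ℝ x y) := by
  rw [vec, vec, CliffordAlgebra.ι_mul_ι_add_swap, QuadraticMap.polar]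
  congr 1
  simp only [euclideanForm, LinearMap.BilinMap.toQuadraticMap_apply, innerₗ_apply_apply,
    inner_add_left, inner_add_right, real_inner_comm x y]
  ring

theorem vec_mul_swap_of_inner_eq_zero {x y : X} (h : inner ℝ x y = 0) :
    vec x * vec y = -(vec y * vec x) := by
  have := vec_mul_add_swap x y
  rw [h] at this
  exact eq_neg_of_add_eq_zero_left (by simpa using this)

/-- `c` anticommutes with both `a` and `b`, and the two signs cancel. -/
theorem commute_vec_mul_vec {a b c : X} (ha : inner ℝ a c = 0) (hb : inner ℝ b c = 0) :
    Commute (vec a * vec b) (vec c) := by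
  rw [Commute, SemiconjBy, mul_assoc, vec_mul_swap_of_inner_eq_zero hb, mul_neg, ← mul_assoc,
    vec_mul_swap_of_inner_eq_zero ha, neg_mul, neg_neg, mul_assoc]

theorem rev_vec (x : X) : rev (vec x) = vec x := CliffordAlgebra.reverse_ι x

theorem rev_mul (M N : Multivector X) : rev (M * N) = rev N * rev M :=
  CliffordAlgebra.reverse.map_mul M N

theorem rev_smul (r : ℝ) (M : Multivector X) : rev (r • M) = r • rev M :=
  map_smul CliffordAlgebra.reverse r M

theorem rev_sub (M N : Multivector X) : rev (M - N) = rev M - rev N :=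
  map_sub CliffordAlgebra.reverse M N

theorem rev_algebraMap (r : ℝ) : rev (algebraMap ℝ (Multivector X) r) = algebraMap ℝ _ r :=
  CliffordAlgebra.reverse.commutes r

theorem scalarPart_algebraMap (r : ℝ) : scalarPart (algebraMap ℝ (Multivector X) r) = r := by
  unfold scalarPart
  rw [CliffordAlgebra.equivExterior, CliffordAlgebra.changeFormEquiv_apply,
    CliffordAlgebra.changeForm_algebraMap]
  exact ExteriorAlgebra.algebraMap_leftInverse X r

end Vectors

/-! ### Exterior and Clifford products of families of vectors. -/

section Products

theorem geomProd_zero (v : Fin 0 → X) : geomProd v = 1 := by simp [geomProd]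

theorem geomProd_succ {p : ℕ} (v : Fin (p + 1) → X) :
    geomProd v = vec (v 0) * geomProd (Matrix.vecTail v) := by
  simp [geomProd, List.ofFn_succ, Matrix.vecTail]

theorem wedge_zero (v : Fin 0 → X) : wedge v = 1 := by
  rw [wedge, ExteriorAlgebra.ιMulti_zero_apply, CliffordAlgebra.equivExterior,
    CliffordAlgebra.changeFormEquiv_symm, CliffordAlgebra.changeFormEquiv_apply]
  exact CliffordAlgebra.changeForm_one _

/-- The splitting `v M = v ∧ M + v ⌋ M`, which makes the canonical identification with `⋀ X`
computable by induction. -/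
theorem wedge_succ {p : ℕ} (v : Fin (p + 1) → X) :
    wedge v = vec (v 0) * wedge (Matrix.vecTail v) -
      CliffordAlgebra.contractLeft (innerₗ X (v 0)) (wedge (Matrix.vecTail v)) := by
  simp only [wedge]
  rw [ExteriorAlgebra.ιMulti_succ_apply, CliffordAlgebra.equivExterior,
    CliffordAlgebra.changeFormEquiv_symm, CliffordAlgebra.changeFormEquiv_apply]
  erw [CliffordAlgebra.changeForm_ι_mul]
  rw [CliffordAlgebra.changeFormEquiv_apply]
  congr 3
  ext y
  simp [QuadraticMap.associated_apply, euclideanForm, inner_add_right,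
    real_inner_comm (v 0) y]
  ring

theorem wedge_pair (x y : X) :
    wedge ![x, y] = vec x * vec y - algebraMap ℝ (Multivector X) (inner ℝ x y) := by
  have h : wedge ![y] = vec y := by
    rw [wedge_succ]
    simp [wedge_zero]
  rw [wedge_succ]
  simp only [Matrix.cons_val_zero, Matrix.tail_cons, h, vec, CliffordAlgebra.contractLeft_ι]
  rfl

theorem contractLeft_geomProd {p : ℕ} (x : X) (v : Fin p → X) (h : ∀ i, inner ℝ x (v i) = 0) :
    CliffordAlgebra.contractLeft (innerₗ X x) (geomProd v) = 0 := by
  induction p with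
  | zero => simp [geomProd_zero]
  | succ p ih =>
    rw [geomProd_succ, vec, CliffordAlgebra.contractLeft_ι_mul,
      ih (Matrix.vecTail v) fun i => h i.succ]
    simp [h 0]

theorem wedge_eq_geomProd {p : ℕ} (v : Fin p → X)
    (h : ∀ i j, i ≠ j → inner ℝ (v i) (v j) = 0) : wedge v = geomProd v := by
  induction p with
  | zero => rw [wedge_zero, geomProd_zero]
  | succ p ih =>
    rw [wedge_succ, geomProd_succ, ih (Matrix.vecTail v) fun i j hij => h _ _ (by simpa using hij),
      contractLeft_geomProd _ (Matrix.vecTail v) fun i => h 0 i.succ (Fin.succ_ne_zero i).symm, sub_zero]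

theorem commute_geomProd {p : ℕ} {M : Multivector X} {v : Fin p → X}
    (h : ∀ i, Commute M (vec (v i))) : Commute M (geomProd v) := by
  induction p with
  | zero => rw [geomProd_zero]; exact Commute.one_right M
  | succ p ih => rw [geomProd_succ]; exact (h 0).mul_right (ih fun i => h i.succ)

theorem commute_rev_geomProd {p : ℕ} {M : Multivector X} {v : Fin p → X}
    (h : ∀ i, Commute M (vec (v i))) : Commute M (rev (geomProd v)) := by
  induction p with
  | zero =>
    rw [geomProd_zero, rev, CliffordAlgebra.reverse.map_one]; exact Commute.one_right M
  | succ p ih =>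
    rw [geomProd_succ, rev_mul, rev_vec]
    exact (ih fun i => h i.succ).mul_right (h 0)

/-- If the pairs `(e i, f i)` lie in pairwise orthogonal planes, the product of the reversed
`e` frame with the `f` frame splits into the products `e i * f i`. -/
theorem rev_geomProd_mul_geomProd {p : ℕ} (e f : Fin p → X)
    (hee : ∀ i j, i ≠ j → inner ℝ (e i) (e j) = 0)
    (hef : ∀ i j, i ≠ j → inner ℝ (e i) (f j) = 0) :
    rev (geomProd e) * geomProd f = (List.ofFn fun i => vec (e i) * vec (f i)).prod := by
  induction p with
  | zero => simp [geomProd_zero, rev]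
  | succ p ih =>
    rw [geomProd_succ, geomProd_succ, rev_mul, rev_vec, List.ofFn_succ, List.prod_cons]
    have hc : Commute (vec (e 0) * vec (f 0)) (rev (geomProd (Matrix.vecTail e))) :=
      commute_rev_geomProd fun i => commute_vec_mul_vec (hee _ _ (Fin.succ_ne_zero i).symm)
        (by rw [real_inner_comm]; exact hef _ _ (Fin.succ_ne_zero i))
    have := ih (Matrix.vecTail e) (Matrix.vecTail f)
      (fun i j hij => hee _ _ (by simpa using hij)) fun i j hij => hef _ _ (by simpa using hij)
    -- The innermost pair `e 0 * f 0` is moved to the front, past the reversed tail.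
    rw [mul_assoc, ← mul_assoc (vec (e 0)), ← mul_assoc, ← hc.eq, mul_assoc, this]
    rfl

theorem rev_geomProd_mul_self {p : ℕ} {e : Fin p → X} (he : Orthonormal ℝ e) :
    rev (geomProd e) * geomProd e = 1 := by
  rw [rev_geomProd_mul_geomProd e e (fun i j h => he.2 h) fun i j h => he.2 h]
  refine List.prod_eq_one fun x hx => ?_
  obtain ⟨i, rfl⟩ := List.mem_ofFn.1 hx
  rw [vec_mul_self, real_inner_self_eq_norm_sq, he.1 i]
  simp

theorem mnorm_smul_geomProd {p : ℕ} {e : Fin p → X} (he : Orthonormal ℝ e) (r : ℝ) :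
    mnorm (r • geomProd e) = |r| := by
  rw [mnorm, rev_smul, smul_mul_smul_comm, rev_geomProd_mul_self he,
    ← Algebra.algebraMap_eq_smul_one, scalarPart_algebraMap, Real.sqrt_mul_self_eq_abs]

theorem mnorm_zero : mnorm (0 : Multivector X) = 0 := by
  have := scalarPart_algebraMap (X := X) 0
  rw [map_zero] at this
  rw [mnorm, mul_zero, this, Real.sqrt_zero]

end Products

/-! ### The plane spanned by two unit vectors. -/

section Pair

variable {x y : X} {t : ℝ}

theorem vec_mul_vec_mul_swap (hx : ‖x‖ = 1) (hy : ‖y‖ = 1) :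
    (vec x * vec y) * (vec y * vec x) = 1 := by
  rw [mul_assoc, ← mul_assoc (vec y), vec_mul_self, ← mul_assoc, ← Algebra.commutes, mul_assoc,
    vec_mul_self, real_inner_self_eq_norm_sq, real_inner_self_eq_norm_sq, hx, hy]
  simp

/-- With `c = cos t`, `(yx - c)(xy - c) = 1 - c (xy + yx) + c² = 1 - c²`, because `xy + yx = 2c`. -/
theorem mnorm_wedge_pair (hx : ‖x‖ = 1) (hy : ‖y‖ = 1) (h : inner ℝ x y = Real.cos t)
    (ht : 0 ≤ Real.sin t) : mnorm (wedge ![x, y]) = Real.sin t := by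
  have h1 := vec_mul_vec_mul_swap hy hx
  have h2 := vec_mul_add_swap x y
  have h3 : rev (wedge ![x, y]) * wedge ![x, y] = algebraMap ℝ (Multivector X) (Real.sin t ^ 2) := by
    rw [wedge_pair, rev_sub, rev_mul, rev_vec, rev_vec, rev_algebraMap, h, sub_mul, mul_sub, mul_sub,
      h1, ← Algebra.commutes, Real.sin_sq]
    rw [h] at h2
    have h4 : vec y * vec x = algebraMap ℝ (Multivector X) (2 * Real.cos t) - vec x * vec y := by
      rw [← h2]; abel
    rw [h4, mul_sub, map_sub, map_mul, map_pow, map_one]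
    simp only [map_ofNat]
    noncomm_ring
  rw [mnorm, h3, scalarPart_algebraMap, Real.sqrt_sq ht]

theorem wedge_pair_mul_self (hx : ‖x‖ = 1) (hy : ‖y‖ = 1) (h : inner ℝ x y = Real.cos t) :
    wedge ![x, y] * wedge ![x, y] = -algebraMap ℝ (Multivector X) (Real.sin t ^ 2) := by
  have h1 := vec_mul_vec_mul_swap hx hy
  have h2 := vec_mul_add_swap x y
  rw [h] at h2
  have h4 : vec y * vec x = algebraMap ℝ (Multivector X) (2 * Real.cos t) - vec x * vec y := by
    rw [← h2]; abel
  rw [h4, mul_sub] at h1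
  have h5 : (vec x * vec y) * (vec x * vec y) =
      (vec x * vec y) * algebraMap ℝ (Multivector X) (2 * Real.cos t) - 1 := by
    rw [← h1]; abel
  rw [wedge_pair, h, sub_mul, mul_sub, mul_sub, h5, ← Algebra.commutes, ← Algebra.commutes,
    Real.sin_sq]
  simp only [map_sub, map_mul, map_pow, map_one, map_ofNat]
  noncomm_ring

end Pair

/-! ### Principal bases and the exponential of the angle bivector. -/

section Principal

variable {p : ℕ} {V W : Submodule ℝ X} {e f : Fin p → X} {θ : Fin p → ℝ}

theorem IsPrincipal.cos_lt_one (h : IsPrincipal V W e f θ) {i : Fin p} (hi : θ i ≠ 0) :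
    0 ≤ Real.cos (θ i) ∧ Real.cos (θ i) < 1 := by
  obtain ⟨h0, h1⟩ := h.angle_mem i
  refine ⟨Real.cos_nonneg_of_mem_Icc ⟨by linarith [Real.pi_pos], h1⟩, ?_⟩
  rw [← Real.cos_zero]
  exact Real.cos_lt_cos_of_nonneg_of_le_pi_div_two le_rfl h1 (lt_of_le_of_ne h0 (Ne.symm hi))

/-- Membership in `V` gives `⟪x, f i⟫ = cos θ i ⟪e i, x⟫`, and membership in `W` gives the same with
`e i` and `f i` exchanged; so `⟪e i, x⟫ (1 - cos² θ i) = 0`. -/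
theorem IsPrincipal.inner_eq_zero_of_mem_inf (h : IsPrincipal V W e f θ) {i : Fin p}
    (hi : θ i ≠ 0) {x : X} (hx : x ∈ V ⊓ W) : inner ℝ (e i) x = 0 := by
  obtain ⟨hV, hW⟩ := hx
  have hcoefV : ∀ y ∈ V, inner ℝ y (f i) = inner ℝ (e i) y * Real.cos (θ i) := by
    intro y hy
    rw [← h.span_left] at hy
    obtain ⟨a, rfl⟩ := (Submodule.mem_span_range_iff_exists_fun ℝ).1 hy
    rw [h.orthonormal_left.inner_right_fintype, sum_inner]
    simp [real_inner_smul_left, h.inner_eq]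
  have hcoefW : ∀ y ∈ W, inner ℝ (e i) y = inner ℝ y (f i) * Real.cos (θ i) := by
    intro y hy
    rw [← h.span_right] at hy
    obtain ⟨a, rfl⟩ := (Submodule.mem_span_range_iff_exists_fun ℝ).1 hy
    rw [h.orthonormal_right.inner_left_fintype, inner_sum]
    simp [real_inner_smul_right, h.inner_eq]
  have h1 := hcoefV x hV
  have h2 := hcoefW x hW
  obtain ⟨c0, c1⟩ := h.cos_lt_one hi
  rw [h1] at h2
  have h3 : inner ℝ (e i) x * (1 - Real.cos (θ i) * Real.cos (θ i)) = 0 := by linarith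
  rcases mul_eq_zero.1 h3 with h4 | h4
  · exact h4
  · nlinarith

/-- The first `dim (V ∩ W)` principal angles vanish. -/
theorem IsPrincipal.angle_eq_zero (h : IsPrincipal V W e f θ) {i : Fin p}
    (hi : (i : ℕ) < Module.finrank ℝ (V ⊓ W : Submodule ℝ X)) : θ i = 0 := by
  by_contra hne
  -- By monotonicity all angles from `i` on are nonzero, so `V ⊓ W` lies in the span of the first
  -- `i` vectors of `e` and has dimension at most `i`.
  have hpos : ∀ j, i ≤ j → θ j ≠ 0 := fun j hj h0 =>
    hne (le_antisymm (h0 ▸ h.angle_monotone hj) (h.angle_mem i).1)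
  let e' : Fin i → X := fun j => e (Fin.castLE i.2.le j)
  have hle : V ⊓ W ≤ Submodule.span ℝ (Set.range e') := by
    intro x hx
    have hxV : x ∈ Submodule.span ℝ (Set.range e) := h.span_left ▸ hx.1
    obtain ⟨a, rfl⟩ := (Submodule.mem_span_range_iff_exists_fun ℝ).1 hxV
    refine Submodule.sum_mem _ fun j _ => ?_
    by_cases hj : j < i
    · exact Submodule.smul_mem _ _ (Submodule.subset_span ⟨⟨j, hj⟩, rfl⟩)
    · have := h.inner_eq_zero_of_mem_inf (hpos j (not_lt.1 hj)) hx
      rw [h.orthonormal_left.inner_right_fintype] at this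
      rw [this, zero_smul]
      exact Submodule.zero_mem _
  have : FiniteDimensional ℝ (Submodule.span ℝ (Set.range e')) :=
    FiniteDimensional.span_of_finite ℝ (Set.finite_range e')
  have h1 := Submodule.finrank_mono hle
  have h2 := finrank_range_le_card (R := ℝ) (b := e')
  rw [Set.finrank, Fintype.card_fin] at h2
  omega

theorem IsPrincipal.eq_of_angle_eq_zero (h : IsPrincipal V W e f θ) {i : Fin p}
    (hi : θ i = 0) : e i = f i := by
  refine (inner_eq_one_iff_of_norm_eq_one (𝕜 := ℝ) (h.orthonormal_left.1 i)
    (h.orthonormal_right.1 i)).1 ?_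
  rw [h.inner_eq, if_pos rfl, hi, Real.cos_zero]

theorem IsPrincipal.sin_pos (h : IsPrincipal V W e f θ) {i : Fin p} (hi : θ i ≠ 0) :
    0 < Real.sin (θ i) :=
  Real.sin_pos_of_pos_of_lt_pi (lt_of_le_of_ne (h.angle_mem i).1 (Ne.symm hi))
    (by linarith [(h.angle_mem i).2, Real.pi_pos])

theorem IsPrincipal.principalBivector_eq (h : IsPrincipal V W e f θ) {i : Fin p}
    (hi : θ i ≠ 0) :
    principalBivector V W e f i = (Real.sin (θ i))⁻¹ • wedge ![e i, f i] := by
  rw [principalBivector, if_neg fun h' => hi (h.angle_eq_zero h'),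
    mnorm_wedge_pair (h.orthonormal_left.1 i) (h.orthonormal_right.1 i)
      (by rw [h.inner_eq, if_pos rfl]) (h.sin_pos hi).le]

theorem IsPrincipal.principalBivector_mul_self (h : IsPrincipal V W e f θ) {i : Fin p}
    (hi : θ i ≠ 0) : principalBivector V W e f i * principalBivector V W e f i = -1 := by
  have hs := (h.sin_pos hi).ne'
  rw [h.principalBivector_eq hi, smul_mul_smul_comm,
    wedge_pair_mul_self (h.orthonormal_left.1 i) (h.orthonormal_right.1 i)
      (by rw [h.inner_eq, if_pos rfl]), smul_neg, Algebra.algebraMap_eq_smul_one, smul_smul]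
  congr 1
  convert one_smul ℝ _
  field_simp

theorem IsPrincipal.vec_mul_vec (h : IsPrincipal V W e f θ) {i : Fin p} (hi : θ i ≠ 0) :
    vec (e i) * vec (f i) =
      Real.cos (θ i) • 1 + Real.sin (θ i) • principalBivector V W e f i := by
  rw [h.principalBivector_eq hi, smul_smul, mul_inv_cancel₀ (h.sin_pos hi).ne', one_smul,
    wedge_pair, h.inner_eq, if_pos rfl, ← Algebra.algebraMap_eq_smul_one]
  abel

theorem IsPrincipal.commute_vec_mul_vec (h : IsPrincipal V W e f θ) {i j : Fin p} (hij : i ≠ j) :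
    Commute (vec (e i) * vec (f i)) (vec (e j) * vec (f j)) := by
  have hfe : inner ℝ (f i) (e j) = 0 := by
    rw [real_inner_comm, h.inner_eq, if_neg hij.symm]
  have hef : inner ℝ (e i) (f j) = 0 := by rw [h.inner_eq, if_neg hij]
  exact (BladeAngle.commute_vec_mul_vec (h.orthonormal_left.2 hij) hfe).mul_right
    (BladeAngle.commute_vec_mul_vec hef (h.orthonormal_right.2 hij))

theorem IsPrincipal.commute_principalBivector (h : IsPrincipal V W e f θ) {i j : Fin p}
    (hij : i ≠ j) : Commute (principalBivector V W e f i) (principalBivector V W e f j) := by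
  unfold principalBivector
  split_ifs
  · exact Commute.zero_left _
  · exact Commute.zero_left _
  · exact Commute.zero_right _
  · rw [wedge_pair, wedge_pair]
    refine Commute.smul_left (Commute.smul_right ?_ _) _
    exact ((h.commute_vec_mul_vec hij).sub_right (Algebra.commutes _ _).symm).sub_left
      (Algebra.commutes _ _)

theorem IsPrincipal.commute_orientedBivector (h : IsPrincipal V W e f θ) {i j : Fin p}
    (hij : i ≠ j) (ε : ℝ) :
    Commute (orientedBivector V W e f ε i) (orientedBivector V W e f ε j) := by
  have := h.commute_principalBivector hij
  unfold orientedBivector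
  split_ifs <;> simpa

variable [FiniteDimensional ℝ X]

theorem IsPrincipal.hasExp_principal (h : IsPrincipal V W e f θ) (i : Fin p) :
    HasExp (θ i • principalBivector V W e f i) (vec (e i) * vec (f i)) := by
  by_cases hi : θ i = 0
  · rw [hi, zero_smul, ← h.eq_of_angle_eq_zero hi, vec_mul_self, real_inner_self_eq_norm_sq,
      h.orthonormal_left.1, one_pow, map_one]
    exact hasExp_zero
  · rw [h.vec_mul_vec hi]
    exact hasExp_smul (h.principalBivector_mul_self hi) _

/-- The condition `θ i ≠ 0` is essential: for a zero angle the bivector is `0`, its exponential is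
`1`, and `-(e i * f i)` is `-1`. -/
theorem IsPrincipal.hasExp_supplementary (h : IsPrincipal V W e f θ) {i : Fin p}
    (hi : θ i ≠ 0) :
    HasExp ((Real.pi - θ i) • -principalBivector V W e f i) (-(vec (e i) * vec (f i))) := by
  have := hasExp_smul (I := -principalBivector V W e f i)
    (by rw [neg_mul_neg, h.principalBivector_mul_self hi]) (Real.pi - θ i)
  rw [Real.cos_pi_sub, Real.sin_pi_sub] at this
  rw [h.vec_mul_vec hi]
  convert this using 1
  module

/-- The exponential of the oriented angle bivector formed with the relative orientation `ε`. -/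
theorem IsPrincipal.hasExp_oriented (h : IsPrincipal V W e f θ) {ε : ℝ} (hε : ε = 1 ∨ ε = -1)
    (hne : ε = -1 → ∃ i, θ i ≠ 0) :
    HasExp (∑ i, orientedAngle θ ε i • orientedBivector V W e f ε i)
      (ε • (rev (geomProd e) * geomProd f)) := by
  rw [rev_geomProd_mul_geomProd e f (fun i j hij => h.orthonormal_left.2 hij)
    fun i j hij => by rw [h.inner_eq, if_neg hij]]
  have hcomm : ∀ i j, i ≠ j → Commute (orientedAngle θ ε i • orientedBivector V W e f ε i)
      (orientedAngle θ ε j • orientedBivector V W e f ε j) := fun i j hij =>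
    ((h.commute_orientedBivector hij ε).smul_left _).smul_right _
  rcases hε with rfl | rfl
  · rw [one_smul]
    refine hasExp_sum _ _ hcomm fun i => ?_
    simpa [orientedAngle, orientedBivector] using h.hasExp_principal i
  · obtain ⟨k, hk⟩ := hne rfl
    cases p with
    | zero => exact k.elim0
    | succ m =>
      -- The last angle is the largest, so one nonzero angle suffices.
      have hlast : θ (Fin.last m) ≠ 0 := fun h0 =>
        hk (le_antisymm (h0 ▸ h.angle_monotone (Fin.le_last k)) (h.angle_mem k).1)
      let g : Fin (m + 1) → Multivector X := fun i =>
        if (i : ℕ) + 1 < m + 1 then vec (e i) * vec (f i) else -(vec (e i) * vec (f i))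
      have hg : (List.ofFn g).prod =
          (-1 : ℝ) • (List.ofFn fun i => vec (e i) * vec (f i)).prod := by
        rw [List.ofFn_succ', List.ofFn_succ', List.prod_concat, List.prod_concat]
        simp [g]
      rw [← hg]
      refine hasExp_sum _ _ hcomm fun i => ?_
      have hone : ¬ ((-1 : ℝ) = 1) := by norm_num
      by_cases hi : (i : ℕ) + 1 < m + 1
      · simp only [orientedAngle, orientedBivector, g, hi, true_or, if_true]
        exact h.hasExp_principal i
      · have : i = Fin.last m := Fin.ext (by have := i.2; simp; omega)
        simp only [orientedAngle, orientedBivector, g, hi, hone, or_self, if_false]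
        exact h.hasExp_supplementary (this ▸ hlast)

end Principal

/-! ### Existence of principal bases and orientations. -/

section Existence

/-- Two subspaces of equal finite dimension admit associated principal bases. -/
theorem exists_isPrincipal [FiniteDimensional ℝ X] {p : ℕ} (V W : Submodule ℝ X)
    (hV : Module.finrank ℝ V = p) (hW : Module.finrank ℝ W = p) :
    ∃ (e f : Fin p → X) (θ : Fin p → ℝ), IsPrincipal V W e f θ := by
  -- The singular vectors of the projection `T` are the principal bases, and its singular values
  -- `√(lam i)` are the cosines of the principal angles.
  let T : V →ₗ[ℝ] W := W.orthogonalProjectionOnto.toLinearMap ∘ₗ V.subtype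
  have hT : ∀ (x : V) (y : W), inner ℝ (T x) y = inner ℝ (x : X) (y : X) := fun x y => by
    simp [T]
  have hS := T.isSymmetric_adjoint_comp_self
  let b := hS.eigenvectorBasis hV
  let lam := hS.eigenvalues hV
  have hTT : ∀ i j, inner ℝ (T (b i)) (T (b j)) = if i = j then lam i else 0 := by
    intro i j
    rw [← LinearMap.adjoint_inner_left]
    have := hS.apply_eigenvectorBasis hV i
    rw [LinearMap.comp_apply] at this
    rw [this]
    simp only [RCLike.ofReal_real_eq_id, id]
    rw [real_inner_smul_left, orthonormal_iff_ite.1 b.orthonormal i j]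
    simp [lam]
  have hlam : ∀ i, 0 ≤ lam i := fun i => by
    have := hTT i i
    rw [if_pos rfl] at this
    rw [← this]; exact real_inner_self_nonneg
  let s : Set (Fin p) := {i | lam i ≠ 0}
  let v : Fin p → W := fun i => (Real.sqrt (lam i))⁻¹ • T (b i)
  -- Only the images with nonzero singular value can be normalized; they are completed arbitrarily
  -- to an orthonormal basis `c` of `W`.
  have hv : Orthonormal ℝ (s.domRestrict v) := by
    classical
    rw [orthonormal_iff_ite]
    rintro ⟨i, hi⟩ ⟨j, hj⟩
    change inner ℝ ((Real.sqrt (lam i))⁻¹ • T (b i)) ((Real.sqrt (lam j))⁻¹ • T (b j)) = _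
    rw [real_inner_smul_left, real_inner_smul_right, hTT]
    simp only [Subtype.mk.injEq]
    split_ifs with hij
    · subst hij
      have h2 := Real.mul_self_sqrt (hlam i)
      rw [← mul_assoc, ← mul_inv, h2, inv_mul_cancel₀ hi]
    · simp
  obtain ⟨c, hc⟩ := hv.exists_orthonormalBasis_extension_of_card_eq (by simp [hW])
  have hTb : ∀ i, T (b i) = Real.sqrt (lam i) • c i := by
    intro i
    by_cases hi : lam i = 0
    · rw [hi, Real.sqrt_zero, zero_smul, ← inner_self_eq_zero (𝕜 := ℝ), hTT, if_pos rfl, hi]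
    · rw [hc i hi, smul_smul, mul_inv_cancel₀ ((Real.sqrt_ne_zero (hlam i)).2 hi), one_smul]
  have hinner : ∀ i j, inner ℝ (b i : X) (c j : X) = if i = j then Real.sqrt (lam i) else 0 := by
    intro i j
    rw [← hT, hTb, real_inner_smul_left, orthonormal_iff_ite.1 c.orthonormal i j]
    simp
  have hbX : Orthonormal ℝ fun i => (b i : X) :=
    b.orthonormal.comp_linearIsometry V.subtypeₗᵢ
  have hcX : Orthonormal ℝ fun i => (c i : X) :=
    c.orthonormal.comp_linearIsometry W.subtypeₗᵢ
  -- By Cauchy–Schwarz; this makes `cos (arccos _)` return the singular value.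
  have hle : ∀ i, Real.sqrt (lam i) ≤ 1 := fun i => by
    have := real_inner_le_norm (b i : X) (c i : X)
    rwa [hinner, if_pos rfl, hbX.1, hcX.1, one_mul] at this
  have hspan : ∀ (U : Submodule ℝ X) (a : OrthonormalBasis (Fin p) ℝ U),
      Submodule.span ℝ (Set.range fun i => (a i : X)) = U := fun U a => by
    have := congrArg (Submodule.map U.subtype) a.toBasis.span_eq
    rw [Submodule.map_span, Submodule.map_subtype_top, ← Set.range_comp] at this
    convert this using 3
    ext i; simp
  refine ⟨fun i => b i, fun i => c i, fun i => Real.arccos (Real.sqrt (lam i)), hbX, hspan V b, hcX,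
    hspan W c, fun i j hij => ?_, fun i => ⟨Real.arccos_nonneg _, ?_⟩, fun i j => ?_⟩
  · exact Real.antitone_arccos (Real.sqrt_le_sqrt (hS.eigenvalues_antitone hV hij))
  · exact Real.arccos_le_pi_div_two.2 (Real.sqrt_nonneg _)
  · rw [hinner, Real.cos_arccos (by linarith [Real.sqrt_nonneg (lam i)]) (hle i)]

/-- An alternating `p`-linear map on a `p`-dimensional space is determined by its value on a basis,
so the factor is a determinant. -/
theorem exists_wedge_eq_smul_wedge {p : ℕ} {v e : Fin p → X} (he : LinearIndependent ℝ e)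
    (h : ∀ i, v i ∈ Submodule.span ℝ (Set.range e)) : ∃ r : ℝ, wedge v = r • wedge e := by
  let b := Module.Basis.span he
  let F := (ExteriorAlgebra.ιMulti ℝ p (M := X)).compLinearMap
    (Submodule.span ℝ (Set.range e)).subtype
  let u : Fin p → Submodule.span ℝ (Set.range e) := fun i => ⟨v i, h i⟩
  refine ⟨b.det u, ?_⟩
  have hF : F = (LinearMap.toSpanSingleton ℝ _ (F b)).compAlternatingMap b.det := by
    refine Module.Basis.ext_alternating b fun w hw => ?_
    let σ := Equiv.ofBijective w (Finite.injective_iff_bijective.1 hw)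
    have h1 : (fun i => b (w i)) = b ∘ σ := rfl
    rw [h1, AlternatingMap.map_perm, LinearMap.compAlternatingMap_apply, AlternatingMap.map_perm,
      b.det_self]
    simp
  have h1 := congrArg (fun G => G u) hF
  have h2 : F u = ExteriorAlgebra.ιMulti ℝ p v := rfl
  have h3 : F b = ExteriorAlgebra.ιMulti ℝ p e := by
    change ExteriorAlgebra.ιMulti ℝ p (fun i => (b i : X)) = _
    congr 1; ext i; exact congrArg Subtype.val (Module.Basis.span_apply he i)
  simp only [LinearMap.compAlternatingMap_apply, LinearMap.toSpanSingleton_apply, h2, h3] at h1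
  rw [wedge, h1, map_smul, wedge]

theorem linearIndependent_of_wedge_ne_zero {p : ℕ} {v : Fin p → X} (h : wedge v ≠ 0) :
    LinearIndependent ℝ v := by
  by_contra hv
  exact h (by rw [wedge, AlternatingMap.map_linearDependent _ v hv, map_zero])

theorem IsBlade.exists_isBladeSpace {p : ℕ} {A : Multivector X} (h : IsBlade p A) (hA : A ≠ 0) :
    ∃ V, IsBladeSpace p A V ∧ Module.finrank ℝ V = p := by
  obtain ⟨r, v, rfl⟩ := h
  refine ⟨_, ⟨r, v, rfl, rfl⟩, ?_⟩
  rw [finrank_span_eq_card (linearIndependent_of_wedge_ne_zero fun h0 => hA (by rw [h0, smul_zero])),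
    Fintype.card_fin]

/-- `A` is a multiple of `geomProd e`, and `ε` is the sign of the coefficient, whose absolute value
is `mnorm A`. -/
theorem IsBladeSpace.exists_hasOrientation {p : ℕ} {A : Multivector X} {V : Submodule ℝ X}
    (h : IsBladeSpace p A V) {e : Fin p → X} (he : Orthonormal ℝ e)
    (hV : Submodule.span ℝ (Set.range e) = V) : ∃ ε, HasOrientation A e ε := by
  obtain ⟨r, v, rfl, rfl⟩ := h
  obtain ⟨s, hs⟩ := exists_wedge_eq_smul_wedge (v := v) he.linearIndependent
    fun i => hV ▸ Submodule.subset_span ⟨i, rfl⟩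
  rw [hs, wedge_eq_geomProd e fun i j hij => he.2 hij, smul_smul]
  unfold HasOrientation
  rw [mnorm_smul_geomProd he]
  rcases abs_cases (r * s) with ⟨h1, -⟩ | ⟨h1, -⟩
  · exact ⟨1, Or.inl rfl, by rw [h1, one_mul]⟩
  · exact ⟨-1, Or.inr rfl, by rw [h1]; simp⟩

end Existence
end BladeAngle

/-! ### The main theorem. -/

theorem theorem4p1 {X : Type*} [NormedAddCommGroup X] [InnerProductSpace ℝ X]
    [FiniteDimensional ℝ X] (p : ℕ) (A B : BladeAngle.Multivector X)
    (hA : BladeAngle.IsBlade p A) (hB : BladeAngle.IsBlade p B)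
    (hAB : ∀ c : ℝ, c < 0 → B = c • A → A = 0) :
    (∃ Φ, BladeAngle.IsOrientedAngleBivector p A B Φ) ∧
    ∀ Φ, BladeAngle.IsOrientedAngleBivector p A B Φ →
      BladeAngle.HasExp Φ (BladeAngle.mexp Φ) ∧
      BladeAngle.rev A * B =
        (BladeAngle.mnorm A * BladeAngle.mnorm B) • BladeAngle.mexp Φ := by
  open BladeAngle in
  refine ⟨?_, fun Φ hΦ => ?_⟩
  · by_cases h0 : A = 0 ∨ B = 0
    · exact ⟨0, Or.inl ⟨h0, rfl⟩⟩
    · obtain ⟨hA0, hB0⟩ := not_or.1 h0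
      obtain ⟨V, hAV, hV⟩ := hA.exists_isBladeSpace hA0
      obtain ⟨W, hBW, hW⟩ := hB.exists_isBladeSpace hB0
      obtain ⟨e, f, θ, h⟩ := exists_isPrincipal V W hV hW
      obtain ⟨εA, hεA⟩ := hAV.exists_hasOrientation h.orthonormal_left h.span_left
      obtain ⟨εB, hεB⟩ := hBW.exists_hasOrientation h.orthonormal_right h.span_right
      exact ⟨_, Or.inr ⟨hA0, hB0, V, W, e, f, θ, εA, εB, hAV, hBW, h, hεA, hεB, rfl⟩⟩
  · rcases hΦ with ⟨h0, rfl⟩ | ⟨hA0, hB0, V, W, e, f, θ, εA, εB, -, -, h, hεA, hεB, rfl⟩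
    · have hexp : HasExp (0 : Multivector X) 1 := hasExp_zero
      rw [hexp.mexp_eq]
      refine ⟨hexp, ?_⟩
      rcases h0 with rfl | rfl <;> simp [rev, mnorm_zero]
    · have hε : εA * εB = 1 ∨ εA * εB = -1 := by
        rcases hεA.1 with rfl | rfl <;> rcases hεB.1 with rfl | rfl <;> norm_num
      have hposA : 0 < mnorm A := lt_of_le_of_ne (Real.sqrt_nonneg _) fun h0 =>
        hA0 (by rw [hεA.2, ← h0, mul_zero, zero_smul])
      have hposB : 0 < mnorm B := lt_of_le_of_ne (Real.sqrt_nonneg _) fun h0 =>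
        hB0 (by rw [hεB.2, ← h0, mul_zero, zero_smul])
      have hexp := h.hasExp_oriented hε fun hneg => by
        -- If all angles vanish, then `e = f` and the opposite orientations force `B = -(‖B‖ / ‖A‖)
        -- A`, which `hAB` excludes.
        by_contra! hall
        have hef : e = f := funext fun i => h.eq_of_angle_eq_zero (hall i)
        refine hA0 (hAB (-(mnorm B / mnorm A)) (neg_lt_zero.2 (div_pos hposB hposA)) ?_)
        have hA2 := hεA.2
        have hB2 := hεB.2
        rw [← hef] at hB2
        have hA3 : -(mnorm B / mnorm A) • A = (-(mnorm B / mnorm A) * (εA * mnorm A)) • geomProd e := by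
          rw [← smul_smul, ← hA2]
        rw [hA3]
        refine hB2.trans ?_
        congr 1
        have hBA : εB = -εA := by
          rcases hεA.1 with rfl | rfl <;> linarith
        rw [hBA]
        field_simp
      rw [hexp.mexp_eq]
      refine ⟨hexp, ?_⟩
      conv_lhs => rw [hεA.2, hεB.2]
      rw [rev_smul, smul_mul_smul_comm, smul_smul]
      congr 1
      ring
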